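/- Notation. All spaces are Euclidean. A set-valued map $\Upsilon\colon\mathbb R^n\rightrightarrows\mathbb R^m$ has graph $\operatorname{gph}\Upsilon=\{(x,y): y\in\Upsilon(x)\}$ and domain $\operatorname{dom}\Upsilon=\{x:\Upsilon(x)\ne\varnothing\}$; its outer limit $\limsup_{x\to\bar x}\Upsilon(x)$ is the set of all $y$ for which there are sequences $x_k\to\bar x$, $y_k\to y$ with $y_k\in\Upsilon(x_k)$ for all $k$. For a set $A$ and $x\in A$ let $\mathcal T_A(x)=\limsup_{t\searrow 0}(A-x)/t$ be the Bouligand tangent cone, $\widehat{\mathcal N}_A(x)=\{v:\langle v,w\rangle\le 0\ \forall w\in\mathcal T_A(x)\}$ the regular normal cone and $\mathcal N_A(x)=\limsup_{x'\to x,\,x'\in A}\widehat{\mathcal N}_A(x')$ the limiting normal cone; for $x\notin A$ both normal cones are empty. The coderivative is $$D^*\Upsilon(x,y)(y^*)=\{x^*: (x^*,-y^*)\in\mathcal N_{\operatorname{gph}\Upsilon}(x,y)\}.$$ $\Upsilon$ is inner semicontinuous at $(\bar x,\bar y)$ if for each sequence $x_k\to\bar x$ in $\operatorname{dom}\Upsilon$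 there are $y_k\to\bar y$ with $y_k\in\Upsilon(x_k)$ for all large $k$; it is inner semicompact at $\bar x$ if for each sequence $x_k\to\bar x$ in $\operatorname{dom}\Upsilon$ there is a bounded sequence $(y_k)$ with $y_k\in\Upsilon(x_k)$ for all large $k$. Theorem. Let $S_1,S_2\colon\mathbb R^n\rightrightarrows\mathbb R^m$ have closed graphs, let $S(x)=S_1(x)+S_2(x)$ (Minkowski sum), and let $$\Xi(x,y)=\{(y_1,y_2)\in\mathbb R^m\times\mathbb R^m: y_1+y_2=y,\ y_1\in S_1(x),\ y_2\in S_2(x)\}.$$ Fix $(\bar x,\bar y)\in\operatorname{gph}S$. For $(\bar y_1,\bar y_2)\in\Xi(\bar x,\bar y)$ and $\bar y_1^*,\bar y_2^*\in\mathbb R^m$ consider the qualification condition $$\limsup_{\substack{(x_1,y_1)\to(\bar x,\bar y_1)\\(x_2,y_2)\to(\bar x,\bar y_2)\\(y_1^*,y_2^*)\to(\bar y_1^*,\bar y_2^*)}}\bigl(D^*S_1(x_1,y_1)(y_1^*)+D^*S_2(x_2,y_2)(y_2^*)\bigr)\subset D^*S_1(\bar x,\bar y_1)(\bar y_1^*)+D^*S_2(\bar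 x,\bar y_2)(\bar y_2^*).\qquad(\mathrm{Q})$$ (a) If $(\bar y_1,\bar y_2)\in\Xi(\bar x,\bar y)$ is such that $\Xi$ is inner semicontinuous at $((\bar x,\bar y),(\bar y_1,\bar y_2))$ and (Q) holds at $(\bar y_1,\bar y_2)$ for all $\bar y_1^*,\bar y_2^*\in\mathbb R^m$, then for all $y^*\in\mathbb R^m$ $$D^*S(\bar x,\bar y)(y^*)\subset D^*S_1(\bar x,\bar y_1)(y^*)+D^*S_2(\bar x,\bar y_2)(y^*).$$ (b) If $\Xi$ is inner semicompact at $(\bar x,\bar y)$ and (Q) holds for each $(\bar y_1,\bar y_2)\in\Xi(\bar x,\bar y)$ and all $\bar y_1^*,\bar y_2^*\in\mathbb R^m$, then for all $y^*\in\mathbb R^m$ $$D^*S(\bar x,\bar y)(y^*)\subset\bigcup_{(\bar y_1,\bar y_2)\in\Xi(\bar x,\bar y)}\bigl(D^*S_1(\bar x,\bar y_1)(y^*)+D^*S_2(\bar x,\bar y_2)(y^*)\bigr).$$ -/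

import Mathlib

open Filter Topology Set
open scoped Pointwise NNReal

namespace VariationalAnalysis

section SetValued

variable {X Y : Type*}

/-- The graph of a set-valued map `Υ : X ⇉ Y`, as a subset of the product `X × Y` carrying the
Euclidean product norm and inner product. -/
def gph (Υ : X → Set Y) : Set (WithLp 2 (X × Y)) :=
  {p | p.snd ∈ Υ p.fst}

/-- The domain of a set-valued map. -/
def dom (Υ : X → Set Y) : Set X :=
  {x | (Υ x).Nonempty}

/-- The sequential outer (Painlevé–Kuratowski) limit of a set-valued map at a point. -/
def outerLimit [TopologicalSpace X] [TopologicalSpace Y] (Υ : X → Set Y) (x₀ : X) : Set Y :=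
  {y | ∃ (x : ℕ → X) (v : ℕ → Y),
    Tendsto x atTop (𝓝 x₀) ∧ Tendsto v atTop (𝓝 y) ∧ ∀ k, v k ∈ Υ (x k)}

/-- Inner semicontinuity of `Υ` at `(x₀, y₀)`: every sequence of points of the domain converging
to `x₀` admits values of `Υ` along it that converge to `y₀`. -/
def InnerSemicontinuousAt [TopologicalSpace X] [TopologicalSpace Y]
    (Υ : X → Set Y) (x₀ : X) (y₀ : Y) : Prop :=
  ∀ x : ℕ → X, Tendsto x atTop (𝓝 x₀) → (∀ k, x k ∈ dom Υ) →
    ∃ y : ℕ → Y, Tendsto y atTop (𝓝 y₀) ∧ ∀ᶠ k in atTop, y k ∈ Υ (x k)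

/-- Inner semicompactness of `Υ` at `x₀`: every sequence of points of the domain converging
to `x₀` admits a bounded sequence of values of `Υ` along it. -/
def InnerSemicompactAt [TopologicalSpace X] [PseudoMetricSpace Y]
    (Υ : X → Set Y) (x₀ : X) : Prop :=
  ∀ x : ℕ → X, Tendsto x atTop (𝓝 x₀) → (∀ k, x k ∈ dom Υ) →
    ∃ y : ℕ → Y, Bornology.IsBounded (range y) ∧ ∀ᶠ k in atTop, y k ∈ Υ (x k)

/-- The more demanding variant of inner semicontinuity, which tests all sequences converging to
`x₀` (so that `x₀` is an interior point of the domain), implies the one above. -/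
theorem InnerSemicontinuousAt.of_forall_seq [TopologicalSpace X] [TopologicalSpace Y]
    {Υ : X → Set Y} {x₀ : X} {y₀ : Y}
    (h : ∀ x : ℕ → X, Tendsto x atTop (𝓝 x₀) →
      ∃ y : ℕ → Y, Tendsto y atTop (𝓝 y₀) ∧ ∀ᶠ k in atTop, y k ∈ Υ (x k)) :
    InnerSemicontinuousAt Υ x₀ y₀ :=
  fun x hx _ => h x hx

/-- The more demanding variant of inner semicompactness, which tests all sequences converging to
`x₀` (so that `x₀` is an interior point of the domain), implies the one above. -/
theorem InnerSemicompactAt.of_forall_seq [TopologicalSpace X] [PseudoMetricSpace Y]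
    {Υ : X → Set Y} {x₀ : X}
    (h : ∀ x : ℕ → X, Tendsto x atTop (𝓝 x₀) →
      ∃ y : ℕ → Y, Bornology.IsBounded (range y) ∧ ∀ᶠ k in atTop, y k ∈ Υ (x k)) :
    InnerSemicompactAt Υ x₀ :=
  fun x hx _ => h x hx

end SetValued

section Cones

variable {E : Type*} [NormedAddCommGroup E] [InnerProductSpace ℝ E]

/-- Mathlib's `posTangentConeAt A x` is the Bouligand tangent cone
`limsup_{t ↘ 0} (A - x) / t`. -/
theorem mem_posTangentConeAt_iff_seq {A : Set E} {x w : E} :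
    w ∈ posTangentConeAt A x ↔ ∃ (t : ℕ → ℝ) (v : ℕ → E), (∀ k, 0 < t k) ∧
      Tendsto t atTop (𝓝 0) ∧ Tendsto v atTop (𝓝 w) ∧ ∀ k, x + t k • v k ∈ A := by
  constructor
  · intro h
    obtain ⟨ι, l, hl, c, d, hd₀, hd, hcd⟩ := exists_fun_of_mem_tangentConeAt h
    have key : ∀ k : ℕ, ∃ (t : ℝ) (v : E), 0 < t ∧ t < 1 / ((k : ℝ) + 1) ∧
        dist v w < 1 / ((k : ℝ) + 1) ∧ x + t • v ∈ A := by
      intro k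
      have hk : (0 : ℝ) < 1 / ((k : ℝ) + 1) := by positivity
      set ε : ℝ := 1 / ((k : ℝ) + 1) with hε
      rcases eq_or_ne w 0 with rfl | hw
      · have h1 : ∀ᶠ n in l, dist (d n) 0 < ε / 2 * ε :=
          hd₀.eventually (Metric.ball_mem_nhds _ (by positivity))
        obtain ⟨n, h1, h2⟩ := (h1.and hd).exists
        refine ⟨ε / 2, (ε / 2)⁻¹ • d n, by positivity, by linarith, ?_, ?_⟩
        · rw [dist_zero_right] at h1 ⊢
          rw [norm_smul, norm_inv, Real.norm_of_nonneg (by positivity)]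
          rw [inv_mul_lt_iff₀ (by positivity)]
          exact h1
        · rw [smul_smul, mul_inv_cancel₀ (by positivity), one_smul]
          exact h2
      · have hw' : 0 < ‖w‖ := norm_pos_iff.2 hw
        have h1 : ∀ᶠ n in l, dist (d n) 0 < ‖w‖ / 2 * ε :=
          hd₀.eventually (Metric.ball_mem_nhds _ (by positivity))
        have h3 : ∀ᶠ n in l, dist (c n • d n) w < min ε (‖w‖ / 2) :=
          hcd.eventually (Metric.ball_mem_nhds _ (by positivity))
        obtain ⟨n, ⟨h1, h2⟩, h3⟩ := ((h1.and hd).and h3).exists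
        have h4 := lt_of_lt_of_le h3 (min_le_left _ _)
        have h5 := lt_of_lt_of_le h3 (min_le_right _ _)
        rw [dist_zero_right] at h1
        rw [dist_eq_norm] at h5
        have h6 : ‖w‖ / 2 < (c n : ℝ) * ‖d n‖ := by
          have := norm_sub_norm_le w (c n • d n)
          rw [norm_sub_rev, NNReal.smul_def, norm_smul,
            Real.norm_of_nonneg (c n).coe_nonneg] at this
          rw [NNReal.smul_def] at h5
          linarith
        have hc : 0 < (c n : ℝ) := by
          rcases (c n).coe_nonneg.eq_or_lt with h0 | h0
          · rw [← h0] at h6; linarith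
          · exact h0
        refine ⟨(c n : ℝ)⁻¹, c n • d n, by positivity, ?_, h4, ?_⟩
        · rw [inv_lt_iff_one_lt_mul₀ hc]
          nlinarith
        · rw [NNReal.smul_def, smul_smul, inv_mul_cancel₀ hc.ne', one_smul]
          exact h2
    choose t v ht ht' hv hA using key
    refine ⟨t, v, ht, ?_, ?_, hA⟩
    · exact squeeze_zero (fun k => (ht k).le) (fun k => (ht' k).le)
        tendsto_one_div_add_atTop_nhds_zero_nat
    · rw [tendsto_iff_dist_tendsto_zero]
      exact squeeze_zero (fun k => dist_nonneg) (fun k => (hv k).le)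
        tendsto_one_div_add_atTop_nhds_zero_nat
  · rintro ⟨t, v, ht, ht0, hv, hA⟩
    refine mem_tangentConeAt_of_seq atTop (fun k => ((t k)⁻¹).toNNReal)
      (fun k => t k • v k) ?_ (Eventually.of_forall hA) ?_
    · simpa using ht0.smul hv
    · refine hv.congr fun k => ?_
      rw [NNReal.smul_def, Real.coe_toNNReal _ (inv_nonneg.2 (ht k).le), smul_smul,
        inv_mul_cancel₀ (ht k).ne', one_smul]

/-- The polar cone `A° = {z | ⟪y, z⟫ ≤ 0 for all y ∈ A}`. -/
def polarCone (A : Set E) : Set E :=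
  {z | ∀ y ∈ A, inner ℝ y z ≤ 0}

/-- The regular (Fréchet) normal cone: the polar of the Bouligand tangent cone at points of `A`,
and empty elsewhere. -/
def regularNormalCone (A : Set E) (x : E) : Set E :=
  {v | x ∈ A ∧ v ∈ polarCone (posTangentConeAt A x)}

/-- The limiting (Mordukhovich) normal cone: the outer limit of the regular normal cones at points
of `A` (regular normal cones being empty off `A`), and empty at points outside `A`. -/
def limitingNormalCone (A : Set E) (x : E) : Set E :=
  {v | x ∈ A ∧ v ∈ outerLimit (regularNormalCone A) x}

end Cones

section Coderivative

variable {X Y : Type*} [NormedAddCommGroup X] [InnerProductSpace ℝ X]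
  [NormedAddCommGroup Y] [InnerProductSpace ℝ Y]

/-- The limiting coderivative `D*Υ(x, y)(y*) = {x* | (x*, -y*) ∈ N_{gph Υ}(x, y)}`. -/
def coderivative (Υ : X → Set Y) (x : X) (y : Y) (ystar : Y) : Set X :=
  {xstar | WithLp.toLp 2 (xstar, -ystar) ∈ limitingNormalCone (gph Υ) (WithLp.toLp 2 (x, y))}

/-- The sum mapping `S(x) = S₁(x) + S₂(x)` (Minkowski sum of the values). -/
def sumMap (S₁ S₂ : X → Set Y) : X → Set Y :=
  fun x => S₁ x + S₂ x

/-- The intermediate mapping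
`Ξ(x, y) = {(y₁, y₂) | y₁ + y₂ = y, y₁ ∈ S₁(x), y₂ ∈ S₂(x)}`. -/
def intermediateMap (S₁ S₂ : X → Set Y) : X × Y → Set (Y × Y) :=
  fun p => {q | q.1 + q.2 = p.2 ∧ q.1 ∈ S₁ p.1 ∧ q.2 ∈ S₂ p.1}

/-- The asymptotic qualification condition at `(x₀, y₁, y₂)` in the directions `(y₁*, y₂*)`: the
outer limit of `D*S₁(x₁, v₁)(v₁*) + D*S₂(x₂, v₂)(v₂*)` as `(x₁, v₁) → (x₀, y₁)`,
`(x₂, v₂) → (x₀, y₂)`, `(v₁*, v₂*) → (y₁*, y₂*)` lies in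
`D*S₁(x₀, y₁)(y₁*) + D*S₂(x₀, y₂)(y₂*)`. -/
def AsymptoticSumCondition (S₁ S₂ : X → Set Y) (x₀ : X) (y₁ y₂ y₁star y₂star : Y) : Prop :=
  outerLimit
      (fun p : (X × Y) × (X × Y) × (Y × Y) =>
        coderivative S₁ p.1.1 p.1.2 p.2.2.1 + coderivative S₂ p.2.1.1 p.2.1.2 p.2.2.2)
      ((x₀, y₁), (x₀, y₂), (y₁star, y₂star)) ⊆
    coderivative S₁ x₀ y₁ y₁star + coderivative S₂ x₀ y₂ y₂star

end Coderivative

end VariationalAnalysis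

/-! A coderivative element of S is a limit of regular normals (u, -p) to gph S at nearby points (x,
a + b), and the hypothesis on Ξ lets the pairs (a, b) converge, along a subsequence in (b). So a
fuzzy rule at each such point suffices (`fuzzy_coderivative_sum`), with (Q) closing the limit.

For the fuzzy rule, the base point is split into two copies x₁, x₂. Over pairs of graph points in a
small ball one minimizes the linear form of (u, -p), with a small quadratic tilt, plus the penalty
N‖x₁ - x₂‖². Regularity of the normal makes the tilted form positive on the sphere when x₁ = x₂
(`coupling_pos`). Compactness extends this to the whole sphere for large N (`exists_penalty_pos`),
while the value at the centre is 0. The minimizer is therefore interior, and freezing either pair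
yields a proximal normal to the other graph.

The multipliers ±2N(x₁ - x₂) have no bound as ε → 0, but they cancel in the sum. This is why (Q)
concerns limits of sums of coderivatives rather than of separate summands. -/

namespace VariationalAnalysis

/-! ### Proximal, regular and limiting normals -/

section NormalCones

variable {E : Type*} [NormedAddCommGroup E] [InnerProductSpace ℝ E]

/-- Proximal normals are regular normals. -/
theorem mem_regularNormalCone_of_proximal {A : Set E} {z v : E} (hz : z ∈ A) (C : ℝ)
    (h : ∀ᶠ w in 𝓝 z, w ∈ A → inner ℝ v (w - z) ≤ C * ‖w - z‖ ^ 2) :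
    v ∈ regularNormalCone A z := by
  refine ⟨hz, fun w hw => ?_⟩
  obtain ⟨t, d, ht, ht0, hd, hA⟩ := mem_posTangentConeAt_iff_seq.1 hw
  have hlim : Tendsto (fun k => z + t k • d k) atTop (𝓝 z) := by
    simpa using tendsto_const_nhds.add (ht0.smul hd)
  have hle : ∀ᶠ k in atTop, inner ℝ (d k) v ≤ C * t k * ‖d k‖ ^ 2 := by
    filter_upwards [hlim.eventually h] with k hk
    have h1 := hk (hA k)
    rw [add_sub_cancel_left, inner_smul_right, norm_smul, Real.norm_of_nonneg (ht k).le] at h1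
    rw [real_inner_comm]
    have h2 : t k * inner ℝ v (d k) ≤ t k * (C * t k * ‖d k‖ ^ 2) := by
      calc _ ≤ _ := h1
        _ = _ := by ring
    exact le_of_mul_le_mul_left h2 (ht k)
  have hr : Tendsto (fun k => C * t k * ‖d k‖ ^ 2) atTop (𝓝 0) := by
    simpa using (ht0.const_mul C).mul (hd.norm.pow 2)
  exact le_of_tendsto_of_tendsto (hd.inner tendsto_const_nhds) hr hle

/-- In finite dimensions, regular normals satisfy the Fréchet normal inequality. -/
theorem eventually_inner_le_of_mem_regularNormalCone [FiniteDimensional ℝ E] {A : Set E} {z v : E}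
    (hv : v ∈ regularNormalCone A z) {ε : ℝ} (hε : 0 < ε) :
    ∀ᶠ w in 𝓝 z, w ∈ A → inner ℝ v (w - z) ≤ ε * ‖w - z‖ := by
  by_contra hcon
  have hfreq : ∃ᶠ w in 𝓝 z, w ∈ A ∧ ε * ‖w - z‖ < inner ℝ v (w - z) :=
    (not_eventually.1 hcon).mono fun w hw => by push Not at hw; exact hw
  obtain ⟨w, hw, hwA⟩ := exists_seq_forall_of_frequently hfreq
  have hpos : ∀ k, 0 < ‖w k - z‖ := fun k => by
    rw [norm_pos_iff]
    intro h0
    simpa [h0] using (hwA k).2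
  -- Unit directions of the violating points subconverge to a tangent d with ⟪d, v⟫ ≥ ε, against
  -- polarity.
  have hsph : ∀ k, ‖w k - z‖⁻¹ • (w k - z) ∈ Metric.sphere (0 : E) 1 := fun k => by
    simp [norm_smul, (hpos k).ne']
  obtain ⟨d, -, φ, hφ, hd⟩ := (isCompact_sphere (0 : E) 1).tendsto_subseq hsph
  have ht : Tendsto (fun k => ‖w k - z‖) atTop (𝓝 0) := by
    simpa using (hw.sub_const z).norm
  have hdT : d ∈ posTangentConeAt A z := by
    refine mem_posTangentConeAt_iff_seq.2 ⟨fun k => ‖w (φ k) - z‖, _, fun k => hpos _,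
      ht.comp hφ.tendsto_atTop, hd, fun k => ?_⟩
    simp only [Function.comp_apply]
    rw [smul_inv_smul₀ (hpos _).ne', add_sub_cancel]
    exact (hwA _).1
  have h1 : ε ≤ inner ℝ d v := by
    refine ge_of_tendsto (hd.inner tendsto_const_nhds) (Eventually.of_forall fun k => ?_)
    simp only [Function.comp_apply]
    rw [real_inner_comm, inner_smul_right, ← div_eq_inv_mul, le_div_iff₀ (hpos _)]
    exact (hwA _).2.le
  linarith [hv.2 d hdT]

theorem regularNormalCone_subset_limitingNormalCone (A : Set E) (z : E) :
    regularNormalCone A z ⊆ limitingNormalCone A z := fun v hv =>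
  ⟨hv.1, fun _ => z, fun _ => v, tendsto_const_nhds, tendsto_const_nhds, fun _ => hv⟩

end NormalCones

/-- Exact penalization on a compact set. -/
theorem exists_penalty_pos {P : Type*} [TopologicalSpace P] {K : Set P} (hK : IsCompact K)
    {G h : P → ℝ} (hG : Continuous G) (hh : Continuous h) (hh0 : ∀ q, 0 ≤ h q)
    (hpos : ∀ q ∈ K, h q = 0 → 0 < G q) : ∃ N : ℝ, 0 ≤ N ∧ ∀ q ∈ K, 0 < G q + N * h q := by
  -- These open sets increase with N because h ≥ 0, so by compactness a single one contains K.
  have hcov : K ⊆ ⋃ N : ℕ, {q | 0 < G q + N * h q} := by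
    intro q hq
    rw [mem_iUnion]
    rcases (hh0 q).eq_or_lt with h0 | h0
    · exact ⟨0, by simpa using hpos q hq h0.symm⟩
    · obtain ⟨N, hN⟩ := exists_nat_gt (-G q / h q)
      refine ⟨N, ?_⟩
      rw [div_lt_iff₀ h0] at hN
      simp only [mem_ofPred_eq]
      linarith
  obtain ⟨N, hN⟩ := hK.elim_directed_cover _
    (fun N : ℕ => isOpen_lt continuous_const
      (by fun_prop : Continuous fun q => G q + (N : ℝ) * h q)) hcov
    (Monotone.directed_le fun N M hNM q hq => by
      have hq' : 0 < G q + N * h q := hq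
      show 0 < G q + M * h q
      have : (N : ℝ) ≤ M := by exact_mod_cast hNM
      nlinarith [hh0 q])
  exact ⟨N, N.cast_nonneg, hN⟩

theorem norm_toLp_prod_sq {X Y : Type*} [NormedAddCommGroup X] [NormedAddCommGroup Y]
    (x : X) (y : Y) : ‖WithLp.toLp 2 (x, y)‖ ^ 2 = ‖x‖ ^ 2 + ‖y‖ ^ 2 := by
  simp [WithLp.prod_norm_sq_eq_of_L2]

theorem mem_dom_intermediateMap {X Y : Type*} [NormedAddCommGroup Y] {S₁ S₂ : X → Set Y}
    {x : X} {y : Y} (h : y ∈ sumMap S₁ S₂ x) : (x, y) ∈ dom (intermediateMap S₁ S₂) := by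
  obtain ⟨a, ha, b, hb, hab⟩ := mem_add.1 h
  exact ⟨(a, b), hab, ha, hb⟩

theorem tendsto_of_norm_sub_le_const_div {Z : Type*} [NormedAddCommGroup Z] {f g : ℕ → Z} {z : Z}
    (C : ℝ) (hg : Tendsto g atTop (𝓝 z)) (hfg : ∀ k, ‖f k - g k‖ ≤ C * (1 / ((k : ℝ) + 1))) :
    Tendsto f atTop (𝓝 z) := by
  have h0 : Tendsto (fun k => f k - g k) atTop (𝓝 0) :=
    squeeze_zero_norm hfg (by simpa using tendsto_one_div_add_atTop_nhds_zero_nat.const_mul C)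
  simpa using h0.add hg

/-! ### Fuzzy sum rule and passage to the limit -/

section SumRule

variable {X Y : Type*} [NormedAddCommGroup X] [InnerProductSpace ℝ X]
  [NormedAddCommGroup Y] [InnerProductSpace ℝ Y]

theorem norm_add_sq_le_two_mul (a b : Y) : ‖a + b‖ ^ 2 ≤ 2 * (‖a‖ ^ 2 + ‖b‖ ^ 2) := by
  nlinarith [norm_add_sq_real a b, norm_sub_sq_real a b, sq_nonneg ‖a - b‖]

/-- A proximal inequality on the graph gives an element of the coderivative. -/
theorem mem_coderivative_of_proximal {S : X → Set Y} {x ξ : X} {y η : Y} (hy : y ∈ S x) (C : ℝ)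
    (h : ∀ᶠ w in 𝓝 (x, y), w.2 ∈ S w.1 →
      inner ℝ ξ (w.1 - x) - inner ℝ η (w.2 - y) ≤ C * (‖w.1 - x‖ ^ 2 + ‖w.2 - y‖ ^ 2)) :
    ξ ∈ coderivative S x y η := by
  refine regularNormalCone_subset_limitingNormalCone _ _
    (mem_regularNormalCone_of_proximal hy C ?_)
  have hc : Tendsto (fun w : WithLp 2 (X × Y) => (w.fst, w.snd)) (𝓝 (WithLp.toLp 2 (x, y)))
      (𝓝 (x, y)) :=
    (WithLp.prod_continuous_ofLp 2 X Y).tendsto _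
  filter_upwards [hc.eventually h] with w hw hwS
  have h1 := hw hwS
  have h2 : w - WithLp.toLp 2 (x, y) = WithLp.toLp 2 (w.fst - x, w.snd - y) := rfl
  rw [h2, norm_toLp_prod_sq, WithLp.prod_inner_apply]
  simpa [inner_neg_left, sub_eq_add_neg] using h1

/-- The tilted quadratic objective of the fuzzy sum rule is positive on a small sphere around the
reference point, along pairs of graph points over a common base point. -/
theorem coupling_pos [FiniteDimensional ℝ X] [FiniteDimensional ℝ Y] {S₁ S₂ : X → Set Y}
    {x₀ u : X} {a₀ b₀ p : Y}
    (hv : WithLp.toLp 2 (u, -p) ∈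
      regularNormalCone (gph (sumMap S₁ S₂)) (WithLp.toLp 2 (x₀, a₀ + b₀)))
    {ε : ℝ} (hε : 0 < ε) :
    ∃ r, 0 < r ∧ r ≤ ε ∧ ∀ x a b, a ∈ S₁ x → b ∈ S₂ x →
      ‖x - x₀‖ ^ 2 + ‖a - a₀‖ ^ 2 + ‖x - x₀‖ ^ 2 + ‖b - b₀‖ ^ 2 = r ^ 2 →
      0 < -inner ℝ u (x - x₀) + inner ℝ p (a - a₀ + (b - b₀)) + 4 * ε / r * r ^ 2 := by
  obtain ⟨δ, hδ, hB⟩ := Metric.eventually_nhds_iff.1 (eventually_inner_le_of_mem_regularNormalCone hv hε)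
  -- With r ≤ δ/4, the bound ‖d‖ ≤ 2r below keeps the displaced point inside the δ-ball. The linear
  -- part is then at least -2εr, and the tilt contributes 4εr.
  refine ⟨min (δ / 4) ε, lt_min (by positivity) hε, min_le_right _ _, ?_⟩
  set r := min (δ / 4) ε with hr
  have hr0 : 0 < r := lt_min (by positivity) hε
  have hrδ : r ≤ δ / 4 := min_le_left _ _
  intro x a b ha hb hρ
  set d : WithLp 2 (X × Y) := WithLp.toLp 2 (x - x₀, a - a₀ + (b - b₀)) with hd
  have hdn : ‖d‖ ≤ 2 * r := by
    refine abs_le_of_sq_le_sq' ?_ (by positivity) |>.2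
    rw [hd, norm_toLp_prod_sq]
    nlinarith [norm_add_sq_le_two_mul (a - a₀) (b - b₀), sq_nonneg ‖x - x₀‖]
  have hsub : WithLp.toLp 2 (x, a + b) - WithLp.toLp 2 (x₀, a₀ + b₀) = d := by
    rw [hd, ← add_sub_add_comm]; rfl
  have h1 := hB (y := WithLp.toLp 2 (x, a + b)) (by rw [dist_eq_norm, hsub]; linarith)
    (add_mem_add ha hb)
  rw [hsub, WithLp.prod_inner_apply] at h1
  simp only [hd, inner_neg_left] at h1
  rw [← hd] at h1
  have h2 : 4 * ε / r * r ^ 2 = 4 * ε * r := by field_simp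
  rw [h2]
  nlinarith

/-- Fuzzy sum rule for regular normals to the graph of a sum of set-valued maps. -/
theorem fuzzy_coderivative_sum [FiniteDimensional ℝ X] [FiniteDimensional ℝ Y] {S₁ S₂ : X → Set Y}
    (hS₁ : IsClosed (gph S₁)) (hS₂ : IsClosed (gph S₂))
    {x₀ u : X} {a₀ b₀ p : Y} (ha₀ : a₀ ∈ S₁ x₀) (hb₀ : b₀ ∈ S₂ x₀)
    (hv : WithLp.toLp 2 (u, -p) ∈
      regularNormalCone (gph (sumMap S₁ S₂)) (WithLp.toLp 2 (x₀, a₀ + b₀)))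
    {ε : ℝ} (hε : 0 < ε) :
    ∃ x₁ a x₂ b p₁ p₂ ξ, ξ ∈ coderivative S₁ x₁ a p₁ + coderivative S₂ x₂ b p₂ ∧
      ‖x₁ - x₀‖ ≤ ε ∧ ‖a - a₀‖ ≤ ε ∧ ‖x₂ - x₀‖ ≤ ε ∧ ‖b - b₀‖ ≤ ε ∧
      ‖p₁ - p‖ ≤ 8 * ε ∧ ‖p₂ - p‖ ≤ 8 * ε ∧ ‖ξ - u‖ ≤ 16 * ε := by
  obtain ⟨r, hr0, hrε, hpos⟩ := coupling_pos hv hε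
  set c : ℝ := 4 * ε / r with hc
  have hc0 : 0 < c := by positivity
  have hcr : c * r = 4 * ε := by rw [hc]; field_simp
  -- On the diagonal x₁ = x₂, ρ counts the base displacement twice, as in `coupling_pos`.
  let ρ : (X × Y) × (X × Y) → ℝ := fun q =>
    ‖q.1.1 - x₀‖ ^ 2 + ‖q.1.2 - a₀‖ ^ 2 + ‖q.2.1 - x₀‖ ^ 2 + ‖q.2.2 - b₀‖ ^ 2
  let G : (X × Y) × (X × Y) → ℝ := fun q =>
    -inner ℝ u (q.1.1 - x₀) + inner ℝ p (q.1.2 - a₀ + (q.2.2 - b₀)) + c * ρ q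
  let h : (X × Y) × (X × Y) → ℝ := fun q => ‖q.1.1 - q.2.1‖ ^ 2
  have hρc : Continuous ρ := by fun_prop
  have hGc : Continuous G := by fun_prop
  have hhc : Continuous h := by fun_prop
  let Γ : Set ((X × Y) × (X × Y)) := {q | q.1.2 ∈ S₁ q.1.1 ∧ q.2.2 ∈ S₂ q.2.1}
  have hΓ : IsClosed Γ :=
    (hS₁.preimage ((WithLp.prod_continuous_toLp 2 X Y).comp continuous_fst)).inter
      (hS₂.preimage ((WithLp.prod_continuous_toLp 2 X Y).comp continuous_snd))
  have hbd : ∀ q, ρ q ≤ r ^ 2 →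
      ‖q.1.1 - x₀‖ ≤ r ∧ ‖q.1.2 - a₀‖ ≤ r ∧ ‖q.2.1 - x₀‖ ≤ r ∧ ‖q.2.2 - b₀‖ ≤ r := by
    intro q hq
    have hq' : ‖q.1.1 - x₀‖ ^ 2 + ‖q.1.2 - a₀‖ ^ 2 + ‖q.2.1 - x₀‖ ^ 2 + ‖q.2.2 - b₀‖ ^ 2
      ≤ r ^ 2 := hq
    refine ⟨?_, ?_, ?_, ?_⟩ <;> refine (sq_le_sq₀ (norm_nonneg _) hr0.le).1 ?_ <;>
      linarith [sq_nonneg ‖q.1.1 - x₀‖, sq_nonneg ‖q.1.2 - a₀‖, sq_nonneg ‖q.2.1 - x₀‖,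
        sq_nonneg ‖q.2.2 - b₀‖]
  have hball : IsCompact {q | ρ q ≤ r ^ 2} := by
    have : ProperSpace X := FiniteDimensional.proper_real X
    have : ProperSpace Y := FiniteDimensional.proper_real Y
    refine (((isCompact_closedBall x₀ r).prod (isCompact_closedBall a₀ r)).prod
      ((isCompact_closedBall x₀ r).prod (isCompact_closedBall b₀ r))).of_isClosed_subset
      (isClosed_le hρc continuous_const) fun q hq => ?_
    obtain ⟨h1, h2, h3, h4⟩ := hbd q hq
    simp only [mem_prod, mem_closedBall_iff_norm]
    exact ⟨⟨h1, h2⟩, h3, h4⟩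
  obtain ⟨N, hN0, hN⟩ := exists_penalty_pos
    (K := ({q | ρ q ≤ r ^ 2} ∩ Γ) ∩ {q | ρ q = r ^ 2})
    ((hball.inter_right hΓ).inter_right (isClosed_eq hρc continuous_const)) hGc hhc
    (fun q => by positivity) (by
      rintro ⟨⟨x₁, a⟩, x₂, b⟩ ⟨⟨-, ha, hb⟩, hρ⟩ h0
      obtain rfl : x₁ = x₂ := sub_eq_zero.1 (by simpa [h] using h0)
      have hρ' : ρ ((x₁, a), x₁, b) = r ^ 2 := hρ
      have := hpos x₁ a b ha hb hρ
      simpa only [G, hρ'] using this)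
  obtain ⟨q, ⟨hqr, hqΓ⟩, hmin⟩ := (hball.inter_right hΓ).exists_isMinOn
    ⟨((x₀, a₀), x₀, b₀), by simp [ρ, sq_nonneg], ha₀, hb₀⟩
    (hGc.add (continuous_const.mul hhc : Continuous fun q => N * h q)).continuousOn
  have hq0 : G q + N * h q ≤ 0 := by
    have := hmin (show ((x₀, a₀), x₀, b₀) ∈ {q | ρ q ≤ r ^ 2} ∩ Γ from
      ⟨by simp [ρ, sq_nonneg], ha₀, hb₀⟩)
    simpa [G, h, ρ] using this
  -- The objective is positive on the sphere but at most 0 at the minimizer, so the ball constraint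
  -- is inactive.
  have hlt : ρ q < r ^ 2 := lt_of_le_of_ne hqr fun heq =>
    absurd (hN q ⟨⟨hqr, hqΓ⟩, heq⟩) (not_lt.2 hq0)
  have hnear : ∀ᶠ w in 𝓝 q, w ∈ Γ → G q + N * h q ≤ G w + N * h w := by
    filter_upwards [(isOpen_lt hρc continuous_const).mem_nhds hlt] with w hw hwΓ
    exact hmin ⟨(show ρ w < r ^ 2 from hw).le, hwΓ⟩
  obtain ⟨⟨x₁, a⟩, x₂, b⟩ := q
  obtain ⟨h1, h2, h3, h4⟩ := hbd _ hqr
  simp only at h1 h2 h3 h4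
  -- The witnesses are the partial gradients of the objective at the minimizer; the linear term in u
  -- is charged to the first copy only. The proximal constant c + N collects the second-order terms
  -- of tilt and penalty.
  refine ⟨x₁, a, x₂, b, p + (2 * c) • (a - a₀), p + (2 * c) • (b - b₀),
    (u - (2 * c) • (x₁ - x₀) - (2 * N) • (x₁ - x₂)) +
      ((2 * N) • (x₁ - x₂) - (2 * c) • (x₂ - x₀)),
    add_mem_add (mem_coderivative_of_proximal hqΓ.1 (c + N) ?_)
      (mem_coderivative_of_proximal hqΓ.2 (c + N) ?_),
    h1.trans hrε, h2.trans hrε, h3.trans hrε, h4.trans hrε, ?_, ?_, ?_⟩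
  · have ht : Tendsto (fun w : X × Y => (w, (x₂, b))) (𝓝 (x₁, a)) (𝓝 ((x₁, a), (x₂, b))) :=
      (Continuous.prodMk_left _).tendsto _
    filter_upwards [ht.eventually hnear] with w hw hwS
    have hle := hw ⟨hwS, hqΓ.2⟩
    obtain ⟨x, y⟩ := w
    obtain ⟨d, rfl⟩ : ∃ d, x = x₁ + d := ⟨x - x₁, by abel⟩
    obtain ⟨e, rfl⟩ : ∃ e, y = a + e := ⟨y - a, by abel⟩
    simp only [add_sub_cancel_left]
    simp only [G, h, ρ, add_sub_right_comm, inner_add_left, inner_add_right,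
      inner_sub_left, inner_smul_left, norm_add_sq_real, RCLike.conj_to_real] at hle ⊢
    nlinarith [hle, mul_nonneg hN0 (sq_nonneg ‖e‖)]
  · have ht : Tendsto (fun w : X × Y => ((x₁, a), w)) (𝓝 (x₂, b)) (𝓝 ((x₁, a), (x₂, b))) :=
      (Continuous.prodMk_right _).tendsto _
    filter_upwards [ht.eventually hnear] with w hw hwS
    have hle := hw ⟨hqΓ.1, hwS⟩
    obtain ⟨x, y⟩ := w
    obtain ⟨d, rfl⟩ : ∃ d, x = x₂ + d := ⟨x - x₂, by abel⟩
    obtain ⟨e, rfl⟩ : ∃ e, y = b + e := ⟨y - b, by abel⟩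
    have hs : ‖x₁ - (x₂ + d)‖ ^ 2 = ‖x₁ - x₂‖ ^ 2 - 2 * inner ℝ (x₁ - x₂) d + ‖d‖ ^ 2 := by
      rw [← sub_sub, norm_sub_sq_real]
    simp only [add_sub_cancel_left]
    simp only [G, h, hs, ρ, add_sub_right_comm x₂ d, add_sub_right_comm b e,
      inner_add_left, inner_add_right, inner_sub_left, inner_smul_left, norm_add_sq_real,
      RCLike.conj_to_real] at hle ⊢
    nlinarith [hle, mul_nonneg hN0 (sq_nonneg ‖e‖)]
  -- The tilt displaces each component by at most 2cr = 8ε; ξ receives two such contributions, hence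
  -- 16ε.
  · rw [add_sub_cancel_left, norm_smul, Real.norm_of_nonneg (by positivity)]
    nlinarith
  · rw [add_sub_cancel_left, norm_smul, Real.norm_of_nonneg (by positivity)]
    nlinarith
  · have : u - (2 * c) • (x₁ - x₀) - (2 * N) • (x₁ - x₂) +
        ((2 * N) • (x₁ - x₂) - (2 * c) • (x₂ - x₀)) - u
        = -((2 * c) • ((x₁ - x₀) + (x₂ - x₀))) := by
      rw [smul_add]; abel
    rw [this, norm_neg, norm_smul, Real.norm_of_nonneg (by positivity)]
    nlinarith [norm_add_le (x₁ - x₀) (x₂ - x₀)]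

/-- The coderivative of a sum along a convergent selection of the intermediate map. -/
theorem coderivative_sum_of_seq [FiniteDimensional ℝ X] [FiniteDimensional ℝ Y]
    {S₁ S₂ : X → Set Y} (hS₁ : IsClosed (gph S₁)) (hS₂ : IsClosed (gph S₂))
    {x₀ u₀ : X} {y₁ y₂ p₀ : Y} (hQ : AsymptoticSumCondition S₁ S₂ x₀ y₁ y₂ p₀ p₀)
    {x u : ℕ → X} {a b p : ℕ → Y} (hx : Tendsto x atTop (𝓝 x₀)) (hu : Tendsto u atTop (𝓝 u₀))
    (ha : Tendsto a atTop (𝓝 y₁)) (hb : Tendsto b atTop (𝓝 y₂)) (hp : Tendsto p atTop (𝓝 p₀))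
    (haS : ∀ k, a k ∈ S₁ (x k)) (hbS : ∀ k, b k ∈ S₂ (x k))
    (hv : ∀ k, WithLp.toLp 2 (u k, -p k) ∈
      regularNormalCone (gph (sumMap S₁ S₂)) (WithLp.toLp 2 (x k, a k + b k))) :
    u₀ ∈ coderivative S₁ x₀ y₁ p₀ + coderivative S₂ x₀ y₂ p₀ := by
  have key := fun k : ℕ => fuzzy_coderivative_sum hS₁ hS₂ (haS k) (hbS k) (hv k)
    (ε := 1 / ((k : ℝ) + 1)) (by positivity)
  choose x₁ a' x₂ b' p₁ p₂ ξ hξ e₁ e₂ e₃ e₄ e₅ e₆ e₇ using key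
  -- Only the sums ξ k need to converge.
  refine hQ ⟨fun k => ((x₁ k, a' k), (x₂ k, b' k), (p₁ k, p₂ k)), ξ, ?_, ?_, hξ⟩
  · have t₁ := tendsto_of_norm_sub_le_const_div 1 hx (by simpa using e₁)
    have t₂ := tendsto_of_norm_sub_le_const_div 1 ha (by simpa using e₂)
    have t₃ := tendsto_of_norm_sub_le_const_div 1 hx (by simpa using e₃)
    have t₄ := tendsto_of_norm_sub_le_const_div 1 hb (by simpa using e₄)
    have t₅ := tendsto_of_norm_sub_le_const_div 8 hp e₅
    have t₆ := tendsto_of_norm_sub_le_const_div 8 hp e₆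
    exact (t₁.prodMk_nhds t₂).prodMk_nhds ((t₃.prodMk_nhds t₄).prodMk_nhds (t₅.prodMk_nhds t₆))
  · exact tendsto_of_norm_sub_le_const_div 16 hu e₇

/-- Sequential description of the coderivative by regular normals. -/
theorem exists_seq_of_mem_coderivative {S : X → Set Y} {x₀ u₀ : X} {y₀ p₀ : Y}
    (h : u₀ ∈ coderivative S x₀ y₀ p₀) :
    ∃ (x u : ℕ → X) (y p : ℕ → Y), Tendsto x atTop (𝓝 x₀) ∧ Tendsto u atTop (𝓝 u₀) ∧
      Tendsto y atTop (𝓝 y₀) ∧ Tendsto p atTop (𝓝 p₀) ∧ (∀ k, y k ∈ S (x k)) ∧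
      ∀ k, WithLp.toLp 2 (u k, -p k) ∈ regularNormalCone (gph S) (WithLp.toLp 2 (x k, y k)) := by
  obtain ⟨-, w, v, hw, hv, hvw⟩ := h
  have hw' := ((WithLp.prod_continuous_ofLp 2 X Y).tendsto _).comp hw
  have hv' := ((WithLp.prod_continuous_ofLp 2 X Y).tendsto _).comp hv
  refine ⟨fun k => (w k).fst, fun k => (v k).fst, fun k => (w k).snd, fun k => -(v k).snd,
    hw'.fst_nhds, hv'.fst_nhds, hw'.snd_nhds, by simpa using hv'.snd_nhds.neg,
    fun k => (hvw k).1, fun k => ?_⟩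
  rw [neg_neg]
  exact hvw k

end SumRule

end VariationalAnalysis

/-! ### The coderivative sum rule -/

theorem mainTheorem11 {n m : ℕ}
    (S₁ S₂ : EuclideanSpace ℝ (Fin n) → Set (EuclideanSpace ℝ (Fin m)))
    (hS₁ : IsClosed (VariationalAnalysis.gph S₁))
    (hS₂ : IsClosed (VariationalAnalysis.gph S₂))
    (xbar : EuclideanSpace ℝ (Fin n)) (ybar : EuclideanSpace ℝ (Fin m))
    (hbar : ybar ∈ VariationalAnalysis.sumMap S₁ S₂ xbar) :
    (∀ y₁ y₂ : EuclideanSpace ℝ (Fin m),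
      (y₁, y₂) ∈ VariationalAnalysis.intermediateMap S₁ S₂ (xbar, ybar) →
      VariationalAnalysis.InnerSemicontinuousAt
        (VariationalAnalysis.intermediateMap S₁ S₂) (xbar, ybar) (y₁, y₂) →
      (∀ y₁star y₂star : EuclideanSpace ℝ (Fin m),
        VariationalAnalysis.AsymptoticSumCondition S₁ S₂ xbar y₁ y₂ y₁star y₂star) →
      ∀ ystar : EuclideanSpace ℝ (Fin m),
        VariationalAnalysis.coderivative (VariationalAnalysis.sumMap S₁ S₂) xbar ybar ystar ⊆
          VariationalAnalysis.coderivative S₁ xbar y₁ ystar +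
            VariationalAnalysis.coderivative S₂ xbar y₂ ystar) ∧
    (VariationalAnalysis.InnerSemicompactAt
        (VariationalAnalysis.intermediateMap S₁ S₂) (xbar, ybar) →
      (∀ y₁ y₂ : EuclideanSpace ℝ (Fin m),
        (y₁, y₂) ∈ VariationalAnalysis.intermediateMap S₁ S₂ (xbar, ybar) →
        ∀ y₁star y₂star : EuclideanSpace ℝ (Fin m),
          VariationalAnalysis.AsymptoticSumCondition S₁ S₂ xbar y₁ y₂ y₁star y₂star) →
      ∀ ystar : EuclideanSpace ℝ (Fin m),
        VariationalAnalysis.coderivative (VariationalAnalysis.sumMap S₁ S₂) xbar ybar ystar ⊆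
          ⋃ q ∈ VariationalAnalysis.intermediateMap S₁ S₂ (xbar, ybar),
            (VariationalAnalysis.coderivative S₁ xbar q.1 ystar +
              VariationalAnalysis.coderivative S₂ xbar q.2 ystar)) := by
  refine ⟨fun y₁ y₂ _ hisc hQ ystar u₀ hu₀ => ?_, fun hisc hQ ystar u₀ hu₀ => ?_⟩
  all_goals
    obtain ⟨x, u, y, p, hx, hu, hy, hp, hyS, hv⟩ :=
      VariationalAnalysis.exists_seq_of_mem_coderivative hu₀
    obtain ⟨q, hq, hqΞ⟩ := hisc (fun k => (x k, y k)) (hx.prodMk_nhds hy)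
      fun k => VariationalAnalysis.mem_dom_intermediateMap (hyS k)
    -- The selection lies in Ξ only eventually, so all sequences are shifted by K.
    obtain ⟨K, hK⟩ := eventually_atTop.1 hqΞ
    have hsh := tendsto_add_atTop_nat K
  · refine VariationalAnalysis.coderivative_sum_of_seq hS₁ hS₂ (hQ ystar ystar) (hx.comp hsh)
      (hu.comp hsh) (hq.fst_nhds.comp hsh) (hq.snd_nhds.comp hsh) (hp.comp hsh)
      (fun k => (hK (k + K) (by lia)).2.1) (fun k => (hK (k + K) (by lia)).2.2) fun k => ?_
    have h1 : (q (k + K)).1 + (q (k + K)).2 = y (k + K) := (hK (k + K) (by lia)).1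
    simpa only [Function.comp_apply, h1] using hv (k + K)
  · obtain ⟨z, -, φ, hφ, hz⟩ := tendsto_subseq_of_bounded hq fun k => mem_range_self k
    have hφ' : Tendsto (fun k => φ (k + K)) atTop atTop := hφ.tendsto_atTop.comp hsh
    have hle : ∀ k, K ≤ φ (k + K) := fun k => (Nat.le_add_left K k).trans (hφ.id_le (k + K))
    have hz' : Tendsto (fun k => q (φ (k + K))) atTop (𝓝 z) := hz.comp hsh
    have hxφ := hx.comp hφ'
    have hsum : ∀ k, (q (φ (k + K))).1 + (q (φ (k + K))).2 = y (φ (k + K)) :=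
      fun k => (hK _ (hle k)).1
    -- Closedness of the graphs keeps the cluster point in Ξ, where (Q) is assumed.
    have hmem : z ∈ VariationalAnalysis.intermediateMap S₁ S₂ (xbar, ybar) := by
      refine ⟨tendsto_nhds_unique (hz'.fst_nhds.add hz'.snd_nhds)
        ((hy.comp hφ').congr fun k => (hsum k).symm), ?_, ?_⟩
      · exact hS₁.mem_of_tendsto (((WithLp.prod_continuous_toLp 2 _ _).tendsto _).comp
          (hxφ.prodMk_nhds hz'.fst_nhds)) (Eventually.of_forall fun k => (hK _ (hle k)).2.1)
      · exact hS₂.mem_of_tendsto (((WithLp.prod_continuous_toLp 2 _ _).tendsto _).comp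
          (hxφ.prodMk_nhds hz'.snd_nhds)) (Eventually.of_forall fun k => (hK _ (hle k)).2.2)
    refine mem_iUnion₂.2 ⟨z, hmem, VariationalAnalysis.coderivative_sum_of_seq hS₁ hS₂
      (hQ z.1 z.2 hmem ystar ystar) hxφ (hu.comp hφ') hz'.fst_nhds hz'.snd_nhds (hp.comp hφ')
      (fun k => (hK _ (hle k)).2.1) (fun k => (hK _ (hle k)).2.2) fun k => ?_⟩
    simpa only [Function.comp_apply, hsum k] using hv (φ (k + K))
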